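/- Let $(X_k)_{k\ge 1}$ be an i.i.d. sequence of nonnegative real random variables whose tail is regularly varying with index $-\beta$, where $\beta\in(0,2)\setminus\{1\}$, that is, $$\lim_{x\to\infty}\frac{\mathbb P[X_1>\Lambda x]}{\mathbb P[X_1>x]}=\Lambda^{-\beta}\qquad\text{for every }\Lambda>0 .$$ Let $S_n=\sum_{k=1}^n X_k$, and put $b_n=0$ if $\beta\in(0,1)$ and $b_n=\mathbb E[S_n]$ if $\beta\in(1,2)$ (in the latter case the $X_k$ are integrable). Then, for every real sequence $(x_n)$ with $x_n\to\infty$ and $n\,\mathbb P[X_1>x_n]\to0$ as $n\to\infty$, $$\lim_{n\to\infty}\ \sup_{x\ge x_n}\left|\frac{\mathbb P[S_n-b_n>x]}{n\,\mathbb P[X_1>x]}-1\right|=0 .$$ -/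

import Mathlib

open MeasureTheory ProbabilityTheory Filter Topology

noncomputable section

/-- The tail distribution function `x ↦ P[X > x]` of a real random variable. -/
def tailDist {Ω : Type*} [MeasurableSpace Ω] (P : Measure Ω) (X : Ω → ℝ) (x : ℝ) : ℝ :=
  P.real {ω | x < X ω}

/-- `F` is regularly varying at infinity with index `-ρ`. Since the limit is nonzero and
`a / 0 = 0`, this forces `F x ≠ 0` for all large `x`. -/
def IsRegularlyVarying (F : ℝ → ℝ) (ρ : ℝ) : Prop :=
  ∀ Λ : ℝ, 0 < Λ → Tendsto (fun x : ℝ => F (Λ * x) / F x) atTop (𝓝 (Λ ^ (-ρ)))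

/-- `S_n`, the sum of the first `n` variables; the sequence `X_1, X_2, …` is
indexed as `X 0, X 1, …`. -/
def partialSum {Ω : Type*} (X : ℕ → Ω → ℝ) (n : ℕ) (ω : Ω) : ℝ :=
  ∑ k ∈ Finset.range n, X k ω

/-- The centering `b_n`: zero if `β < 1`, and `E[S_n]` otherwise. -/
def centering {Ω : Type*} [MeasurableSpace Ω] (P : Measure Ω) (X : ℕ → Ω → ℝ)
    (β : ℝ) (n : ℕ) : ℝ :=
  if β < 1 then 0 else ∫ ω, partialSum X n ω ∂P

end

/-! This is the single big jump principle. Write `F` for the tail and `s = n * F y`. Cut the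
summands at `τ * y`. Apart from rare events, the truncated sum stays within `η * y` of the centering
and at most one summand exceeds the cut, so the centered sum passes `y` essentially when one summand
passes about `y`. That has probability close to `s`, since `F ((1 ± η) * y)` is close to `F y`.

The errors are small relative to `s`. Two large summands cost `(n * F (τ * y)) ^ 2`, of order `s ^
2` for fixed `τ`. Karamata bounds, proved by dyadic iteration, control the rest: the second moment
gives a Chebyshev error of order `τ ^ (2 - β) * s / η ^ 2`, and the first moment gives a centering
bias of order `s * y`. Choosing `η`, then `τ`, then a bound on `s` makes everything small. Since `n`
enters only through `s`, `exists_abs_tailDist_partialSum_sub_le` is uniform in `n` and `y`. -/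

theorem tailDist_antitone {Ω : Type*} [MeasurableSpace Ω] (P : Measure Ω) [IsFiniteMeasure P]
    (Y : Ω → ℝ) : Antitone (tailDist P Y) := fun _ _ hab =>
  measureReal_mono fun _ hω => lt_of_le_of_lt hab hω

/-- A zero of `F` would make the quotient with `Λ = 1` equal to `0` there, while its limit is `1`;
monotonicity carries positivity from large arguments to all. -/
theorem IsRegularlyVarying.pos {F : ℝ → ℝ} {β : ℝ} (hRV : IsRegularlyVarying F β)
    (hF : Antitone F) (h0 : ∀ x, 0 ≤ F x) (x : ℝ) : 0 < F x := by
  have h1 : ∀ᶠ y in atTop, 0 < F (1 * y) / F y :=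
    (hRV 1 one_pos).eventually (lt_mem_nhds (Real.rpow_pos_of_pos one_pos _))
  obtain ⟨y, hy, hxy⟩ := (h1.and (eventually_ge_atTop x)).exists
  have : F y ≠ 0 := fun h => by simp [h] at hy
  exact lt_of_lt_of_le (lt_of_le_of_ne (h0 y) this.symm) (hF hxy)

theorem IsRegularlyVarying.eventually_lt_mul {F : ℝ → ℝ} {β : ℝ} (hRV : IsRegularlyVarying F β)
    (hpos : ∀ x, 0 < F x) {Λ c : ℝ} (hΛ : 0 < Λ) (hc : Λ ^ (-β) < c) :
    ∀ᶠ x in atTop, F (Λ * x) < c * F x := by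
  filter_upwards [(hRV Λ hΛ).eventually (gt_mem_nhds hc)] with x hx
  exact (div_lt_iff₀ (hpos x)).1 hx

theorem IsRegularlyVarying.eventually_mul_lt {F : ℝ → ℝ} {β : ℝ} (hRV : IsRegularlyVarying F β)
    (hpos : ∀ x, 0 < F x) {Λ c : ℝ} (hΛ : 0 < Λ) (hc : c < Λ ^ (-β)) :
    ∀ᶠ x in atTop, c * F x < F (Λ * x) := by
  filter_upwards [(hRV Λ hΛ).eventually (lt_mem_nhds hc)] with x hx
  exact (lt_div_iff₀ (hpos x)).1 hx

/-- A one-sided Karamata bound for truncated moments, obtained by iterating over dyadic scales. -/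
theorem IsRegularlyVarying.exists_truncated_moment_le {F G : ℝ → ℝ} {β : ℝ} (p : ℕ) (hβ : β < p)
    (hRV : IsRegularlyVarying F β) (hF : Antitone F) (hpos : ∀ x, 0 < F x)
    (hG : ∀ t, 0 < t → G t ≤ t ^ p)
    (hG2 : ∀ t, 0 < t → G (2 * t) ≤ G t + (2 * t) ^ p * F t) :
    ∃ C > 0, ∃ M > 0, ∀ t ≥ M, G t ≤ C * t ^ p * F t := by
  -- With `2 ^ (-p) < q < 2 ^ (-β)`, doubling `t` eventually multiplies `t ^ p * F t` by at least `2
  -- ^ p * q > 1`.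
  obtain ⟨q, hq1, hq2⟩ := exists_between
    (Real.rpow_lt_rpow_of_exponent_lt one_lt_two (neg_lt_neg hβ))
  obtain ⟨M₀, hM₀⟩ := eventually_atTop.1 (hRV.eventually_mul_lt hpos two_pos hq2)
  set M := max M₀ 1
  have hM : 0 < M := lt_of_lt_of_le one_pos (le_max_right _ _)
  have hA : 1 < 2 ^ p * q := by
    rw [Real.rpow_neg two_pos.le, Real.rpow_natCast, inv_lt_iff_one_lt_mul₀' (by positivity)] at hq1
    exact hq1
  -- The first entry closes the dyadic induction step; the second covers the base range `[M, 2 *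
  -- M]`.
  set C := max (2 ^ p / (2 ^ p * q - 1)) (1 / F (2 * M))
  have hC0 : 0 < C := lt_max_of_lt_right (one_div_pos.2 (hpos _))
  have hC : 2 ^ p + C ≤ C * (2 ^ p * q) := by
    have : 2 ^ p / (2 ^ p * q - 1) ≤ C := le_max_left _ _
    rw [div_le_iff₀ (by linarith)] at this
    linarith
  refine ⟨C, hC0, M, hM, ?_⟩
  have key : ∀ N : ℕ, ∀ t, M ≤ t → t ≤ 2 ^ N * (2 * M) → G t ≤ C * t ^ p * F t := by
    have base : ∀ t, M ≤ t → t ≤ 2 * M → G t ≤ C * t ^ p * F t := by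
      intro t h1 h2
      have ht : 0 < t := hM.trans_le h1
      have h3 : 1 ≤ C * F t := by
        have h4 : 1 / F (2 * M) ≤ C := le_max_right _ _
        rw [div_le_iff₀ (hpos _)] at h4
        exact h4.trans (mul_le_mul_of_nonneg_left (hF h2) hC0.le)
      calc G t ≤ t ^ p := hG t ht
        _ ≤ t ^ p * (C * F t) := le_mul_of_one_le_right (by positivity) h3
        _ = _ := by ring
    intro N
    induction N with
    | zero => simpa using base
    | succ N ih =>
      intro t h1 h2
      by_cases h3 : t ≤ 2 * M
      · exact base t h1 h3
      obtain ⟨s, rfl⟩ : ∃ s, t = 2 * s := ⟨t / 2, by ring⟩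
      have hs : M ≤ s := by linarith
      have hs0 : 0 < s := hM.trans_le hs
      have h4 := ih s hs (by rw [pow_succ] at h2; linarith)
      have h5 : q * F s ≤ F (2 * s) := (hM₀ s ((le_max_left _ _).trans hs)).le
      calc G (2 * s) ≤ G s + (2 * s) ^ p * F s := hG2 s hs0
        _ ≤ C * s ^ p * F s + (2 * s) ^ p * F s := by linarith
        _ = (2 ^ p + C) * (s ^ p * F s) := by rw [mul_pow]; ring
        _ ≤ C * (2 ^ p * q) * (s ^ p * F s) :=
          mul_le_mul_of_nonneg_right hC (mul_nonneg (by positivity) (hpos s).le)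
        _ = C * (2 * s) ^ p * (q * F s) := by rw [mul_pow]; ring
        _ ≤ _ := mul_le_mul_of_nonneg_left h5 (by positivity)
  intro t ht
  obtain ⟨N, hN⟩ := pow_unbounded_of_one_lt (t / (2 * M)) one_lt_two
  exact key N t ht (by rw [div_lt_iff₀ (by positivity)] at hN; exact hN.le)

/-- The identity on `[0, t]`, extended by zero. -/
noncomputable def posTrunc (t x : ℝ) : ℝ := (Set.Icc 0 t).indicator id x

theorem measurable_posTrunc (t : ℝ) : Measurable (posTrunc t) :=
  measurable_id.indicator measurableSet_Icc

theorem posTrunc_nonneg (t x : ℝ) : 0 ≤ posTrunc t x :=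
  Set.indicator_nonneg (fun _ h => h.1) x

theorem posTrunc_le {t : ℝ} (ht : 0 ≤ t) (x : ℝ) : posTrunc t x ≤ t :=
  Set.indicator_le' (fun _ h => h.2) (fun _ _ => ht) x

theorem posTrunc_of_le {t x : ℝ} (h0 : 0 ≤ x) (h : x ≤ t) : posTrunc t x = x :=
  Set.indicator_of_mem (Set.mem_Icc.2 ⟨h0, h⟩) _

theorem posTrunc_of_lt {t x : ℝ} (h : t < x) : posTrunc t x = 0 :=
  Set.indicator_of_notMem (fun hx => absurd hx.2 (not_le.2 h)) _

theorem posTrunc_le_self {t x : ℝ} (h0 : 0 ≤ x) : posTrunc t x ≤ x :=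
  Set.indicator_le_self' (fun _ _ => h0) x

/-! ### Truncated moments and the bias of the truncated mean -/

section Moments
variable {Ω : Type*} [MeasurableSpace Ω] {P : Measure Ω} [IsProbabilityMeasure P] {Y : Ω → ℝ}

theorem memLp_posTrunc (hY : Measurable Y) (t : ℝ) (r : ENNReal) :
    MemLp (fun ω => posTrunc t (Y ω)) r P := by
  refine MemLp.of_bound ((measurable_posTrunc t).comp hY).aestronglyMeasurable |t|
    (ae_of_all _ fun ω => ?_)
  rw [Real.norm_of_nonneg (posTrunc_nonneg _ _)]
  by_cases ht : 0 ≤ t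
  · exact (posTrunc_le ht _).trans (le_abs_self t)
  · rw [posTrunc, Set.Icc_eq_empty ht]; simp

theorem integrable_posTrunc_pow (hY : Measurable Y) {t : ℝ} (ht : 0 ≤ t) (p : ℕ) :
    Integrable (fun ω => posTrunc t (Y ω) ^ p) P := by
  refine Integrable.of_bound (C := t ^ p)
    (((measurable_posTrunc t).comp hY).pow_const p).aestronglyMeasurable (ae_of_all _ fun ω => ?_)
  rw [Real.norm_of_nonneg (pow_nonneg (posTrunc_nonneg _ _) _)]
  exact pow_le_pow_left₀ (posTrunc_nonneg _ _) (posTrunc_le ht _) p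

theorem exists_integral_posTrunc_pow_le (hY : Measurable Y) {β : ℝ} {p : ℕ} (hp : p ≠ 0)
    (hβ : β < p) (hRV : IsRegularlyVarying (tailDist P Y) β) (hpos : ∀ x, 0 < tailDist P Y x) :
    ∃ C > 0, ∃ M > 0, ∀ t ≥ M, ∫ ω, posTrunc t (Y ω) ^ p ∂P ≤ C * t ^ p * tailDist P Y t := by
  refine hRV.exists_truncated_moment_le (G := fun t => ∫ ω, posTrunc t (Y ω) ^ p ∂P) p hβ
    (tailDist_antitone P Y) hpos (fun t ht => ?_) (fun t ht => ?_)
  · calc ∫ ω, posTrunc t (Y ω) ^ p ∂P ≤ ∫ _, t ^ p ∂P :=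
        integral_mono (integrable_posTrunc_pow hY ht.le p) (integrable_const _) fun ω =>
          pow_le_pow_left₀ (posTrunc_nonneg _ _) (posTrunc_le ht.le _) p
      _ = t ^ p := by simp
  · have hm : MeasurableSet {ω | t < Y ω} := measurableSet_lt measurable_const hY
    have hi : Integrable ({ω | t < Y ω}.indicator fun _ => (2 * t) ^ p) P :=
      (integrable_const _).indicator hm
    calc ∫ ω, posTrunc (2 * t) (Y ω) ^ p ∂P
        ≤ ∫ ω, posTrunc t (Y ω) ^ p + {ω | t < Y ω}.indicator (fun _ => (2 * t) ^ p) ω ∂P := by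
          refine integral_mono (integrable_posTrunc_pow hY (by positivity) p)
            ((integrable_posTrunc_pow hY ht.le p).add hi) fun ω => ?_
          by_cases h : t < Y ω
          · have h' : ω ∈ {ω | t < Y ω} := h
            simp only [Set.indicator_of_mem h', posTrunc_of_lt h, zero_pow hp, zero_add]
            exact pow_le_pow_left₀ (posTrunc_nonneg _ _) (posTrunc_le (by positivity) _) p
          · have h' : ω ∉ {ω | t < Y ω} := h
            simp only [Set.indicator_of_notMem h', add_zero]
            refine pow_le_pow_left₀ (posTrunc_nonneg _ _) ?_ p
            by_cases h0 : 0 ≤ Y ω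
            · exact (posTrunc_le_self h0).trans_eq (posTrunc_of_le h0 (not_lt.1 h)).symm
            · rw [posTrunc, Set.indicator_of_notMem (fun h => h0 h.1)]
              exact posTrunc_nonneg _ _
      _ = _ := by
          rw [integral_add (integrable_posTrunc_pow hY ht.le p) hi, integral_indicator_const _ hm,
            smul_eq_mul, mul_comm]
          rfl

/-- The one-sided Karamata bound for the upper part of the mean when the index exceeds one. -/
theorem exists_lintegral_tail_le (hY : Measurable Y) {β : ℝ}
    (hβ : 1 < β) (hRV : IsRegularlyVarying (tailDist P Y) β) (hpos : ∀ x, 0 < tailDist P Y x) :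
    ∃ C > 0, ∃ M > 0, ∀ t ≥ M,
      ∫⁻ ω in {ω | t < Y ω}, ENNReal.ofReal (Y ω) ∂P ≤ ENNReal.ofReal (C * t * tailDist P Y t) := by
  have h12 : (2 : ℝ) ^ (-β) < 1 / 2 := by
    have := Real.rpow_lt_rpow_of_exponent_lt one_lt_two (neg_lt_neg hβ)
    rwa [Real.rpow_neg_one, ← one_div] at this
  obtain ⟨q, hq1, hq2⟩ := exists_between h12
  obtain ⟨M₀, hM₀⟩ := eventually_atTop.1 (hRV.eventually_lt_mul hpos two_pos hq1)
  set M := max M₀ 1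
  have hM : 0 < M := lt_of_lt_of_le one_pos (le_max_right _ _)
  -- The fixed point of `C = 2 + 2 * q * C`, positive because `q < 1 / 2`: the block `(t, 2t]`
  -- contributes `2` and the tail beyond `2t` contributes `2 * q * C`.
  set C := 2 / (1 - 2 * q)
  have hC0 : 0 < C := div_pos two_pos (by linarith)
  have hC : 2 + 2 * q * C = C := by
    have : (1 - 2 * q) ≠ 0 := by linarith
    simp only [C]; field_simp; ring
  refine ⟨C, hC0, M, hM, ?_⟩
  -- The cap `2 ^ N * t` gives the induction an empty start; the bound is free of `N`, so the cap
  -- can be removed by monotone convergence.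
  have key : ∀ N : ℕ, ∀ t ≥ M, ∫⁻ ω in {ω | t < Y ω ∧ Y ω ≤ 2 ^ N * t}, ENNReal.ofReal (Y ω) ∂P
      ≤ ENNReal.ofReal (C * t * tailDist P Y t) := by
    intro N
    induction N with
    | zero =>
      intro t ht
      have : {ω | t < Y ω ∧ Y ω ≤ 2 ^ 0 * t} = ∅ := by
        ext ω; simp
      rw [this]; simp
    | succ N ih =>
      intro t ht
      have ht0 : 0 < t := hM.trans_le ht
      have hsub : {ω | t < Y ω ∧ Y ω ≤ 2 ^ (N + 1) * t} ⊆
          {ω | t < Y ω ∧ Y ω ≤ 2 * t} ∪ {ω | 2 * t < Y ω ∧ Y ω ≤ 2 ^ N * (2 * t)} := by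
        rintro ω ⟨h1, h2⟩
        by_cases h : Y ω ≤ 2 * t
        · exact Or.inl ⟨h1, h⟩
        · exact Or.inr ⟨not_le.1 h, by rw [pow_succ] at h2; linarith⟩
      have hm : MeasurableSet {ω | t < Y ω ∧ Y ω ≤ 2 * t} :=
        (measurableSet_lt measurable_const hY).inter (measurableSet_le hY measurable_const)
      have h1 : ∫⁻ ω in {ω | t < Y ω ∧ Y ω ≤ 2 * t}, ENNReal.ofReal (Y ω) ∂P
          ≤ ENNReal.ofReal (2 * t * tailDist P Y t) := by
        calc _ ≤ ∫⁻ ω in {ω | t < Y ω ∧ Y ω ≤ 2 * t}, ENNReal.ofReal (2 * t) ∂P :=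
              setLIntegral_mono' hm fun ω hω => ENNReal.ofReal_le_ofReal hω.2
          _ = ENNReal.ofReal (2 * t) * P {ω | t < Y ω ∧ Y ω ≤ 2 * t} := setLIntegral_const _ _
          _ ≤ ENNReal.ofReal (2 * t) * P {ω | t < Y ω} := by
              gcongr; exact fun h => h.1
          _ = _ := by
              rw [ENNReal.ofReal_mul (p := 2 * t) (by positivity), tailDist, ofReal_measureReal]
      calc _ ≤ _ := lintegral_mono_set hsub
        _ ≤ _ := lintegral_union_le _ _ _
        _ ≤ ENNReal.ofReal (2 * t * tailDist P Y t)
            + ENNReal.ofReal (C * (2 * t) * tailDist P Y (2 * t)) :=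
          add_le_add h1 (ih (2 * t) (by linarith))
        _ = ENNReal.ofReal (2 * t * tailDist P Y t + C * (2 * t) * tailDist P Y (2 * t)) :=
          (ENNReal.ofReal_add (mul_nonneg (by positivity) (hpos _).le)
            (mul_nonneg (by positivity) (hpos _).le)).symm
        _ ≤ _ := by
          refine ENNReal.ofReal_le_ofReal ?_
          have h5 : tailDist P Y (2 * t) ≤ q * tailDist P Y t :=
            (hM₀ t ((le_max_left _ _).trans ht)).le
          calc _ ≤ 2 * t * tailDist P Y t + C * (2 * t) * (q * tailDist P Y t) := by gcongr
            _ = (2 + 2 * q * C) * t * tailDist P Y t := by ring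
            _ = _ := by rw [hC]
  intro t ht
  have ht0 : 0 < t := hM.trans_le ht
  have hU : {ω | t < Y ω} = ⋃ N : ℕ, {ω | t < Y ω ∧ Y ω ≤ 2 ^ N * t} := by
    ext ω
    simp only [Set.mem_ofPred_eq, Set.mem_iUnion, exists_and_left]
    refine ⟨fun h => ⟨h, ?_⟩, fun h => h.1⟩
    obtain ⟨N, hN⟩ := pow_unbounded_of_one_lt (Y ω / t) one_lt_two
    exact ⟨N, by rw [div_lt_iff₀ ht0] at hN; exact hN.le⟩
  have hmono : Monotone fun N : ℕ => {ω | t < Y ω ∧ Y ω ≤ 2 ^ N * t} := by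
    intro a b hab ω hω
    refine ⟨hω.1, hω.2.trans ?_⟩
    gcongr
    exact one_le_two
  rw [hU, setLIntegral_iUnion_of_directed _ hmono.directed_le]
  exact iSup_le fun N => key N t ht

theorem integrable_of_lintegral_tail (hY : Measurable Y) (h0 : ∀ᵐ ω ∂P, 0 ≤ Y ω) {t : ℝ}
    (h : ∫⁻ ω in {ω | t < Y ω}, ENNReal.ofReal (Y ω) ∂P ≠ ⊤) : Integrable Y P := by
  refine ⟨hY.aestronglyMeasurable, ?_⟩
  rw [hasFiniteIntegral_iff_ofReal h0,
    ← lintegral_add_compl _ (measurableSet_lt measurable_const hY : MeasurableSet {ω | t < Y ω})]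
  refine ENNReal.add_lt_top.2 ⟨h.lt_top, ?_⟩
  calc _ ≤ ∫⁻ ω in {ω | t < Y ω}ᶜ, ENNReal.ofReal t ∂P :=
        setLIntegral_mono' (measurableSet_lt measurable_const hY).compl fun ω hω =>
          ENNReal.ofReal_le_ofReal (not_lt.1 hω)
    _ < ⊤ := by
      rw [setLIntegral_const]
      exact ENNReal.mul_lt_top ENNReal.ofReal_lt_top (measure_lt_top _ _)

/-- For `β < 1` the truncated mean is itself of this order; for `β > 1` the difference is the mean
carried by `{t < Y}`. Neither Karamata bound covers `β = 1`. -/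
theorem exists_abs_integral_posTrunc_sub_le (hY : Measurable Y) (h0 : ∀ᵐ ω ∂P, 0 ≤ Y ω) {β : ℝ}
    (hβ : β ≠ 1) (hRV : IsRegularlyVarying (tailDist P Y) β) (hpos : ∀ x, 0 < tailDist P Y x) :
    ∃ C > 0, ∃ M > 0, ∀ t ≥ M,
      |∫ ω, posTrunc t (Y ω) ∂P - (if β < 1 then 0 else ∫ ω, Y ω ∂P)|
        ≤ C * t * tailDist P Y t := by
  rcases lt_or_gt_of_ne hβ with hβ | hβ
  · simp only [if_pos hβ, sub_zero]
    obtain ⟨C, hC, M, hM, h⟩ := exists_integral_posTrunc_pow_le hY (p := 1) one_ne_zero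
      (by simpa using hβ) hRV hpos
    refine ⟨C, hC, M, hM, fun t ht => ?_⟩
    rw [abs_of_nonneg (integral_nonneg fun ω => posTrunc_nonneg _ _)]
    simpa using h t ht
  · simp only [if_neg (not_lt.2 hβ.le)]
    obtain ⟨C, hC, M, hM, h⟩ := exists_lintegral_tail_le hY hβ hRV hpos
    refine ⟨C, hC, M, hM, fun t ht => ?_⟩
    have hm : MeasurableSet {ω | t < Y ω} := measurableSet_lt measurable_const hY
    have hi : Integrable Y P :=
      integrable_of_lintegral_tail hY h0 (ne_top_of_le_ne_top ENNReal.ofReal_ne_top (h t ht))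
    have hd : ∫ ω, Y ω ∂P = ∫ ω, posTrunc t (Y ω) ∂P + ∫ ω in {ω | t < Y ω}, Y ω ∂P := by
      rw [← integral_indicator hm, ← integral_add ((memLp_posTrunc hY t 1).integrable le_rfl)
        (hi.indicator hm)]
      refine integral_congr_ae (h0.mono fun ω hω => ?_)
      by_cases hc : t < Y ω
      · have hc' : ω ∈ {ω | t < Y ω} := hc
        simp only [Set.indicator_of_mem hc', posTrunc_of_lt hc, zero_add]
      · have hc' : ω ∉ {ω | t < Y ω} := hc
        simp only [Set.indicator_of_notMem hc', posTrunc_of_le hω (not_lt.1 hc), add_zero]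
    have ht0 : 0 < t := hM.trans_le ht
    have hnn : 0 ≤ ∫ ω in {ω | t < Y ω}, Y ω ∂P :=
      setIntegral_nonneg hm fun ω hω => (ht0.trans hω).le
    rw [hd, sub_add_cancel_left, abs_neg, abs_of_nonneg hnn,
      integral_eq_lintegral_of_nonneg_ae (ae_restrict_of_ae h0) hY.aestronglyMeasurable]
    exact ENNReal.toReal_le_of_le_ofReal
      (mul_nonneg (by positivity) (hpos t).le) (h t ht)

end Moments

/-! ### Union bounds, Bonferroni and Chebyshev for independent copies -/

section Independence
variable {Ω : Type*} [MeasurableSpace Ω] {P : Measure Ω} {X : ℕ → Ω → ℝ}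

theorem measureReal_tail_inter (hindep : iIndepFun X P)
    (hident : ∀ k, IdentDistrib (X k) (X 0) P P) (t : ℝ) {j k : ℕ} (hjk : j ≠ k) :
    P.real ({ω | t < X j ω} ∩ {ω | t < X k ω}) = tailDist P (X 0) t ^ 2 := by
  have h := (hindep.indepFun hjk).measure_inter_preimage_eq_mul (Set.Ioi t) (Set.Ioi t)
    measurableSet_Ioi measurableSet_Ioi
  rw [(hident j).measure_mem_eq measurableSet_Ioi, (hident k).measure_mem_eq measurableSet_Ioi] at h
  have h' := congrArg ENNReal.toReal h
  rw [ENNReal.toReal_mul, ← sq] at h'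
  exact h'

theorem measureReal_tail_eq (hident : ∀ k, IdentDistrib (X k) (X 0) P P) (t : ℝ) (k : ℕ) :
    P.real {ω | t < X k ω} = tailDist P (X 0) t :=
  congrArg ENNReal.toReal ((hident k).measure_mem_eq measurableSet_Ioi)

theorem measureReal_exists_tail_le (hident : ∀ k, IdentDistrib (X k) (X 0) P P) (t : ℝ) (n : ℕ) :
    P.real (⋃ k ∈ Finset.range n, {ω | t < X k ω}) ≤ n * tailDist P (X 0) t := by
  refine (measureReal_biUnion_finset_le _ _).trans_eq ?_
  simp [measureReal_tail_eq hident]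

theorem measureReal_two_tails_le (hindep : iIndepFun X P)
    (hident : ∀ k, IdentDistrib (X k) (X 0) P P) (t : ℝ) (n : ℕ) :
    P.real (⋃ p ∈ (Finset.range n).offDiag, {ω | t < X p.1 ω} ∩ {ω | t < X p.2 ω})
      ≤ (n * tailDist P (X 0) t) ^ 2 := by
  refine (measureReal_biUnion_finset_le _ _).trans ?_
  rw [Finset.sum_congr rfl fun p hp =>
    measureReal_tail_inter hindep hident t (Finset.mem_offDiag.1 hp).2.2]
  rw [Finset.sum_const, nsmul_eq_mul, mul_pow]
  refine mul_le_mul_of_nonneg_right ?_ (sq_nonneg _)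
  rw [Finset.offDiag_card, Finset.card_range, sq]
  exact_mod_cast Nat.sub_le _ _

variable [IsProbabilityMeasure P]

/-- A Bonferroni bound by induction: adding the event of index `n` loses at most `n * a ^ 2` in
overlaps, less than the growth of `(n * a) ^ 2`. -/
theorem le_measureReal_exists_tail (hmeas : ∀ k, Measurable (X k)) (hindep : iIndepFun X P)
    (hident : ∀ k, IdentDistrib (X k) (X 0) P P) (t : ℝ) (n : ℕ) :
    n * tailDist P (X 0) t - (n * tailDist P (X 0) t) ^ 2
      ≤ P.real (⋃ k ∈ Finset.range n, {ω | t < X k ω}) := by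
  induction n with
  | zero => simp
  | succ n ih =>
    set a := tailDist P (X 0) t
    have ha : 0 ≤ a := measureReal_nonneg
    have hm : MeasurableSet {ω | t < X n ω} := measurableSet_lt measurable_const (hmeas n)
    have h1 := measureReal_union_add_inter (μ := P) (s := ⋃ k ∈ Finset.range n, {ω | t < X k ω}) hm
      (measure_ne_top _ _) (measure_ne_top _ _)
    have h2 : P.real ((⋃ k ∈ Finset.range n, {ω | t < X k ω}) ∩ {ω | t < X n ω}) ≤ n * a ^ 2 := by
      simp only [Set.iUnion_inter]
      refine (measureReal_biUnion_finset_le _ _).trans_eq ?_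
      rw [Finset.sum_congr rfl fun k hk =>
        measureReal_tail_inter hindep hident t (Finset.mem_range.1 hk).ne]
      simp [a]
    rw [measureReal_tail_eq hident] at h1
    have h3 : (⋃ k ∈ Finset.range (n + 1), {ω | t < X k ω})
        = (⋃ k ∈ Finset.range n, {ω | t < X k ω}) ∪ {ω | t < X n ω} := by
      rw [Finset.range_add_one, Finset.set_biUnion_insert, Set.union_comm]
    rw [h3]
    push_cast
    nlinarith [mul_nonneg n.cast_nonneg (sq_nonneg a), sq_nonneg a]

/-- Chebyshev's inequality for a sum of truncated variables around a nearby centering. -/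
theorem measureReal_abs_sum_posTrunc_sub_gt_le (hmeas : ∀ k, Measurable (X k))
    (hindep : iIndepFun X P) (hident : ∀ k, IdentDistrib (X k) (X 0) P P) {t c r : ℝ} (hr : 0 < r)
    (n : ℕ) (hc : |n * ∫ ω, posTrunc t (X 0 ω) ∂P - c| ≤ r) :
    P.real {ω | 2 * r < |∑ k ∈ Finset.range n, posTrunc t (X k ω) - c|}
      ≤ n * (∫ ω, posTrunc t (X 0 ω) ^ 2 ∂P) / r ^ 2 := by
  set Z : ℕ → Ω → ℝ := fun k ω => posTrunc t (X k ω)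
  have hZ : ∀ k, MemLp (Z k) 2 P := fun k => memLp_posTrunc (hmeas k) t 2
  have hZi : ∀ k, IdentDistrib (Z k) (Z 0) P P := fun k => (hident k).comp (measurable_posTrunc t)
  have hmean : ∫ ω, (∑ k ∈ Finset.range n, Z k) ω ∂P = n * ∫ ω, posTrunc t (X 0 ω) ∂P := by
    simp only [Finset.sum_apply]
    rw [integral_finsetSum _ fun k _ => (hZ k).integrable one_le_two,
      Finset.sum_congr rfl fun k _ => (hZi k).integral_eq]
    simp [Z]
  have hvar : variance (∑ k ∈ Finset.range n, Z k) P ≤ n * ∫ ω, posTrunc t (X 0 ω) ^ 2 ∂P := by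
    rw [IndepFun.variance_sum (fun k _ => hZ k) fun i _ j _ hij =>
      (hindep.indepFun hij).comp (measurable_posTrunc t) (measurable_posTrunc t),
      Finset.sum_congr rfl fun k _ => (hZi k).variance_eq]
    rw [Finset.sum_const, Finset.card_range, nsmul_eq_mul]
    exact mul_le_mul_of_nonneg_left (variance_le_expectation_sq (hZ 0).aestronglyMeasurable)
      n.cast_nonneg
  have hcheb := meas_ge_le_variance_div_sq (memLp_finsetSum' (Finset.range n) fun k _ => hZ k) hr
  calc _ ≤ P.real {ω | r ≤ |(∑ k ∈ Finset.range n, Z k) ω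
          - ∫ ω, (∑ k ∈ Finset.range n, Z k) ω ∂P|} := by
        refine measureReal_mono fun ω hω => ?_
        have hω' : 2 * r < |∑ k ∈ Finset.range n, posTrunc t (X k ω) - c| := hω
        change r ≤ |(∑ k ∈ Finset.range n, Z k) ω - ∫ ω, (∑ k ∈ Finset.range n, Z k) ω ∂P|
        rw [hmean, Finset.sum_apply]
        -- The bias uses at most `r` of the deviation `2 * r`, leaving `r` for the fluctuation.
        have := abs_sub_le (∑ k ∈ Finset.range n, posTrunc t (X k ω))
          (n * ∫ ω, posTrunc t (X 0 ω) ∂P) c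
        simp only [Z]
        linarith
    _ ≤ variance (∑ k ∈ Finset.range n, Z k) P / r ^ 2 :=
        ENNReal.toReal_le_of_le_ofReal (div_nonneg (variance_nonneg _ _) (sq_nonneg _)) hcheb
    _ ≤ _ := by gcongr

end Independence

/-! ### Pathwise comparison with a single large summand -/

section Inclusions

/-- Truncation removes at most one term, and that term is at most `s`. -/
theorem sum_le_sum_posTrunc_add {n : ℕ} {u : ℕ → ℝ} {t s : ℝ} (hu : ∀ k, 0 ≤ u k) (hs : 0 ≤ s)
    (h1 : ∀ k ∈ Finset.range n, u k ≤ s)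
    (h2 : ∀ j ∈ Finset.range n, ∀ k ∈ Finset.range n, j ≠ k → ¬ (t < u j ∧ t < u k)) :
    ∑ k ∈ Finset.range n, u k ≤ ∑ k ∈ Finset.range n, posTrunc t (u k) + s := by
  by_cases h : ∃ k ∈ Finset.range n, t < u k
  · obtain ⟨k, hk, htk⟩ := h
    rw [← Finset.add_sum_erase _ _ hk, ← Finset.add_sum_erase _ (fun k => posTrunc t (u k)) hk,
      posTrunc_of_lt htk, Finset.sum_congr rfl (g := fun k => posTrunc t (u k)) fun j hj => ?_]
    · linarith [h1 k hk]
    · obtain ⟨hjk, hj⟩ := Finset.mem_erase.1 hj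
      exact (posTrunc_of_le (hu j) (not_lt.1 fun hj' => h2 j hj k hk hjk ⟨hj', htk⟩)).symm
  · push Not at h
    rw [Finset.sum_congr rfl fun k hk => posTrunc_of_le (hu k) (h k hk)]
    linarith

theorem sum_posTrunc_add_le_sum {n : ℕ} {u : ℕ → ℝ} {t : ℝ} (hu : ∀ k, 0 ≤ u k) {k : ℕ}
    (hk : k ∈ Finset.range n) (htk : t < u k) :
    ∑ k ∈ Finset.range n, posTrunc t (u k) + u k ≤ ∑ k ∈ Finset.range n, u k := by
  rw [← Finset.add_sum_erase _ u hk, ← Finset.add_sum_erase _ (fun k => posTrunc t (u k)) hk,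
    posTrunc_of_lt htk]
  have := Finset.sum_le_sum (s := (Finset.range n).erase k) fun j _ =>
    posTrunc_le_self (t := t) (hu j)
  linarith

variable {Ω : Type*} [MeasurableSpace Ω] {P : Measure Ω} [IsProbabilityMeasure P] {X : ℕ → Ω → ℝ}

theorem tailDist_partialSum_sub_le (hnonneg : ∀ k, ∀ᵐ ω ∂P, 0 ≤ X k ω) (hindep : iIndepFun X P)
    (hident : ∀ k, IdentDistrib (X k) (X 0) P P) (n : ℕ) {c y η t : ℝ} (hy : 0 ≤ (1 - η) * y) :
    tailDist P (fun ω => partialSum X n ω - c) y ≤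
      n * tailDist P (X 0) ((1 - η) * y) + (n * tailDist P (X 0) t) ^ 2
        + P.real {ω | η * y < |∑ k ∈ Finset.range n, posTrunc t (X k ω) - c|} := by
  set A := ⋃ k ∈ Finset.range n, {ω | (1 - η) * y < X k ω}
  set B := ⋃ p ∈ (Finset.range n).offDiag, {ω | t < X p.1 ω} ∩ {ω | t < X p.2 ω}
  set D := {ω | η * y < |∑ k ∈ Finset.range n, posTrunc t (X k ω) - c|}
  have hsub : {ω | y < partialSum X n ω - c} ≤ᵐ[P] (A ∪ B ∪ D : Set Ω) := by
    filter_upwards [ae_all_iff.2 hnonneg] with ω hω hlt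
    by_contra hn
    have hlt' : y < partialSum X n ω - c := hlt
    have hn' : ¬ (ω ∈ A ∪ B ∪ D) := hn
    rw [Set.mem_union, Set.mem_union, not_or, not_or] at hn'
    obtain ⟨⟨nA, nB⟩, nD⟩ := hn'
    have h1 : ∀ k ∈ Finset.range n, X k ω ≤ (1 - η) * y := fun k hk => not_lt.1 fun h =>
      nA (Set.mem_biUnion hk h)
    have h2 : ∀ j ∈ Finset.range n, ∀ k ∈ Finset.range n, j ≠ k → ¬ (t < X j ω ∧ t < X k ω) :=
      fun j hj k hk hjk h => nB
        (Set.mem_biUnion (x := (j, k)) (Finset.mem_offDiag.2 ⟨hj, hk, hjk⟩) h)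
    have h3 : |∑ k ∈ Finset.range n, posTrunc t (X k ω) - c| ≤ η * y := not_lt.1 nD
    have h4 := sum_le_sum_posTrunc_add (u := fun k => X k ω) hω hy h1 h2
    have h5 := (abs_le.1 h3).2
    simp only [partialSum] at hlt'
    linarith
  calc _ ≤ P.real (A ∪ B ∪ D) :=
        ENNReal.toReal_mono (measure_ne_top _ _) (measure_mono_ae hsub)
    _ ≤ P.real A + P.real B + P.real D :=
        (measureReal_union_le _ _).trans (add_le_add_left (measureReal_union_le _ _) _)
    _ ≤ _ := by
        gcongr
        · exact measureReal_exists_tail_le hident _ n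
        · exact measureReal_two_tails_le hindep hident t n

theorem le_tailDist_partialSum_sub (hmeas : ∀ k, Measurable (X k))
    (hnonneg : ∀ k, ∀ᵐ ω ∂P, 0 ≤ X k ω) (hindep : iIndepFun X P)
    (hident : ∀ k, IdentDistrib (X k) (X 0) P P) (n : ℕ) {c y η t : ℝ} (ht : t ≤ (1 + η) * y) :
    n * tailDist P (X 0) ((1 + η) * y) - (n * tailDist P (X 0) ((1 + η) * y)) ^ 2
        - P.real {ω | η * y < |∑ k ∈ Finset.range n, posTrunc t (X k ω) - c|} ≤
      tailDist P (fun ω => partialSum X n ω - c) y := by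
  set A := ⋃ k ∈ Finset.range n, {ω | (1 + η) * y < X k ω}
  set D := {ω | η * y < |∑ k ∈ Finset.range n, posTrunc t (X k ω) - c|}
  have hsub : A ≤ᵐ[P] ({ω | y < partialSum X n ω - c} ∪ D : Set Ω) := by
    filter_upwards [ae_all_iff.2 hnonneg] with ω hω hA'
    change ω ∈ {ω | y < partialSum X n ω - c} ∪ D
    by_cases nD : ω ∈ D
    · exact Or.inr nD
    refine Or.inl ?_
    obtain ⟨k, hk, hlt⟩ := Set.mem_iUnion₂.1 (show ω ∈ A from hA')
    have hlt' : (1 + η) * y < X k ω := hlt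
    have h3 : |∑ k ∈ Finset.range n, posTrunc t (X k ω) - c| ≤ η * y := not_lt.1 nD
    have h4 := sum_posTrunc_add_le_sum (u := fun k => X k ω) hω hk (ht.trans_lt hlt)
    have h5 := (abs_le.1 h3).1
    change y < partialSum X n ω - c
    simp only [partialSum]
    linarith
  have h1 : P.real A ≤ P.real ({ω | y < partialSum X n ω - c} ∪ D) :=
    ENNReal.toReal_mono (measure_ne_top _ _) (measure_mono_ae hsub)
  have h2 := h1.trans (measureReal_union_le _ _)
  have h3 := le_measureReal_exists_tail hmeas hindep hident ((1 + η) * y) n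
  change _ ≤ P.real {ω | y < partialSum X n ω - c}
  linarith

end Inclusions

/-! ### Choice of parameters and the uniform estimate -/

section Uniform
variable {Ω : Type*} [MeasurableSpace Ω] {P : Measure Ω} {X : ℕ → Ω → ℝ}

theorem centering_eq (hident : ∀ k, IdentDistrib (X k) (X 0) P P) {β : ℝ}
    (hint : 1 < β → ∀ k, Integrable (X k) P) (hβ : β ≠ 1) (n : ℕ) :
    centering P X β n = n * (if β < 1 then 0 else ∫ ω, X 0 ω ∂P) := by
  unfold centering
  split_ifs with h
  · simp
  · simp only [partialSum]
    rw [integral_finsetSum _ fun k _ => hint (lt_of_le_of_ne (not_lt.1 h) hβ.symm) k,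
      Finset.sum_congr rfl fun k _ => (hident k).integral_eq]
    simp

variable [IsProbabilityMeasure P]

/-- The single big jump principle, uniformly in the number of summands and the level. -/
theorem exists_abs_tailDist_partialSum_sub_le (hmeas : ∀ k, Measurable (X k))
    (hnonneg : ∀ k, ∀ᵐ ω ∂P, 0 ≤ X k ω) (hindep : iIndepFun X P)
    (hident : ∀ k, IdentDistrib (X k) (X 0) P P) {β : ℝ} (hβ2 : β < 2) (hβ1 : β ≠ 1)
    (hRV : IsRegularlyVarying (tailDist P (X 0)) β) (hpos : ∀ x, 0 < tailDist P (X 0) x)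
    (hint : 1 < β → ∀ k, Integrable (X k) P) {ε : ℝ} (hε : 0 < ε) :
    ∃ δ > 0, ∃ M, ∀ (n : ℕ), ∀ y ≥ M, n * tailDist P (X 0) y ≤ δ →
      |tailDist P (fun ω => partialSum X n ω - centering P X β n) y - n * tailDist P (X 0) y|
        ≤ ε * (n * tailDist P (X 0) y) := by
  set F := tailDist P (X 0)
  obtain ⟨C₁, hC₁, M₁, -, hmean⟩ :=
    exists_abs_integral_posTrunc_sub_le (hmeas 0) (hnonneg 0) hβ1 hRV hpos
  obtain ⟨C₂, hC₂, M₂, -, hsq⟩ :=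
    exists_integral_posTrunc_pow_le (hmeas 0) (p := 2) two_ne_zero (by exact_mod_cast hβ2) hRV hpos
  have hcont : Tendsto (fun x : ℝ => x ^ (-β)) (𝓝 1) (𝓝 1) := by
    have h := Real.continuousAt_rpow_const 1 (-β) (Or.inl one_ne_zero)
    rw [ContinuousAt, Real.one_rpow] at h
    exact h
  obtain ⟨η, ⟨hη1, hη2⟩, hη0, hηhalf⟩ : ∃ η : ℝ,
      ((1 - η) ^ (-β) < 1 + ε / 4 ∧ 1 - ε / 4 < (1 + η) ^ (-β)) ∧ 0 < η ∧ η < 1 / 2 := by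
    have hm : Tendsto (fun η : ℝ => 1 - η) (𝓝[>] 0) (𝓝 1) := by
      refine (Continuous.tendsto' (by fun_prop) _ _ (by simp)).mono_left nhdsWithin_le_nhds
    have hp : Tendsto (fun η : ℝ => 1 + η) (𝓝[>] 0) (𝓝 1) := by
      refine (Continuous.tendsto' (by fun_prop) _ _ (by simp)).mono_left nhdsWithin_le_nhds
    have e1 := (hcont.comp hm).eventually (gt_mem_nhds (show (1 : ℝ) < 1 + ε / 4 by linarith))
    have e2 := (hcont.comp hp).eventually (lt_mem_nhds (show 1 - ε / 4 < (1 : ℝ) by linarith))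
    exact ((e1.and e2).and (Ioo_mem_nhdsGT (by norm_num))).exists
  -- This is the Chebyshev error relative to `s`, small since `2 - β > 0`; the `2` comes from `K`
  -- and the `4` from `(η / 2) ^ 2`.
  obtain ⟨τ, hτ, hτ0, hτ1⟩ : ∃ τ : ℝ,
      2 * C₂ * τ ^ (2 - β) * 4 / η ^ 2 < ε / 4 ∧ 0 < τ ∧ τ < 1 := by
    have h := Real.continuousAt_rpow_const 0 (2 - β) (Or.inr (by linarith))
    rw [ContinuousAt, Real.zero_rpow (by linarith)] at h
    have h' : Tendsto (fun τ : ℝ => 2 * C₂ * τ ^ (2 - β) * 4 / η ^ 2) (𝓝[>] 0) (𝓝 0) := by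
      have := (((h.mono_left (nhdsWithin_le_nhds (s := Set.Ioi 0))).const_mul (2 * C₂)).mul_const
        4).div_const (η ^ 2)
      simpa using this
    exact ((h'.eventually (gt_mem_nhds (show (0 : ℝ) < ε / 4 by linarith))).and
      (Ioo_mem_nhdsGT one_pos)).exists
  have hτβ : 0 < τ ^ (-β) := Real.rpow_pos_of_pos hτ0 _
  set K := 2 * τ ^ (-β) with hK
  have hK0 : 0 < K := by positivity
  -- The three entries control, in order, the Bonferroni loss, the event of two large summands and
  -- the centering bias.
  set δ := min (ε / 4) (min (ε / 4 / K ^ 2) (η / 2 / (C₁ * τ * K)))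
  have hδ0 : 0 < δ := by positivity
  obtain ⟨M₃, hM₃⟩ := eventually_atTop.1 ((hRV.eventually_lt_mul hpos (by linarith) hη1).and
    ((hRV.eventually_mul_lt hpos (by linarith) hη2).and
    (hRV.eventually_lt_mul hpos hτ0 (show τ ^ (-β) < K by linarith))))
  refine ⟨δ, hδ0, max (max 1 M₃) (max (M₁ / τ) (M₂ / τ)), fun n y hy hs => ?_⟩
  have hy1 : 1 ≤ y := ((le_max_left _ _).trans (le_max_left _ _)).trans hy
  obtain ⟨f1, f2, f3⟩ := hM₃ y (((le_max_right _ _).trans (le_max_left _ _)).trans hy)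
  have hyM₁ : M₁ ≤ τ * y := by
    rw [← div_le_iff₀' hτ0]
    exact ((le_max_left _ _).trans (le_max_right _ _)).trans hy
  have hyM₂ : M₂ ≤ τ * y := by
    rw [← div_le_iff₀' hτ0]
    exact ((le_max_right _ _).trans (le_max_right _ _)).trans hy
  have hm := hmean _ hyM₁
  have hq := hsq _ hyM₂
  have hn0 : (0 : ℝ) ≤ n := n.cast_nonneg
  set s := n * F y with hsdef
  have hs0 : 0 ≤ s := mul_nonneg hn0 (hpos y).le
  have hnτ : n * F (τ * y) ≤ K * s := by
    calc n * F (τ * y) ≤ n * (K * F y) := by gcongr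
      _ = K * s := by rw [hsdef]; ring
  have hδ1 : s ≤ ε / 4 := hs.trans (min_le_left _ _)
  have hδ2 : K ^ 2 * s ≤ ε / 4 := by
    rw [← le_div_iff₀' (by positivity)]
    exact hs.trans ((min_le_right _ _).trans (min_le_left _ _))
  have hδ3 : C₁ * τ * K * s ≤ η / 2 := by
    rw [← le_div_iff₀' (by positivity)]
    exact hs.trans ((min_le_right _ _).trans (min_le_right _ _))
  have hcen : |n * ∫ ω, posTrunc (τ * y) (X 0 ω) ∂P - centering P X β n| ≤ η / 2 * y := by
    rw [centering_eq hident hint hβ1, ← mul_sub, abs_mul, abs_of_nonneg hn0]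
    calc _ ≤ n * (C₁ * (τ * y) * F (τ * y)) := by gcongr
      _ = C₁ * τ * y * (n * F (τ * y)) := by ring
      _ ≤ C₁ * τ * y * (K * s) := by gcongr
      _ = C₁ * τ * K * s * y := by ring
      _ ≤ η / 2 * y := by gcongr
  have hdev := measureReal_abs_sum_posTrunc_sub_gt_le hmeas hindep hident
    (show 0 < η / 2 * y by positivity) n hcen
  rw [show 2 * (η / 2 * y) = η * y by ring] at hdev
  set D := P.real {ω | η * y <
    |∑ k ∈ Finset.range n, posTrunc (τ * y) (X k ω) - centering P X β n|}
  have hD : D ≤ ε / 4 * s := by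
    refine hdev.trans ?_
    calc _ ≤ n * (C₂ * (τ * y) ^ 2 * F (τ * y)) / (η / 2 * y) ^ 2 := by gcongr
      _ = C₂ * (τ * y) ^ 2 * (n * F (τ * y)) / (η / 2 * y) ^ 2 := by ring
      _ ≤ C₂ * (τ * y) ^ 2 * (K * s) / (η / 2 * y) ^ 2 := by gcongr
      _ = 2 * C₂ * τ ^ (2 - β) * 4 / η ^ 2 * s := by
        rw [sub_eq_add_neg, Real.rpow_add hτ0, hK, Real.rpow_two]
        field_simp
        ring
      _ ≤ ε / 4 * s := by gcongr
  have hup := tailDist_partialSum_sub_le hnonneg hindep hident n (c := centering P X β n) (y := y)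
    (η := η) (t := τ * y) (mul_nonneg (by linarith) (by linarith))
  have hlo := le_tailDist_partialSum_sub hmeas hnonneg hindep hident n (c := centering P X β n)
    (y := y) (η := η) (t := τ * y) (by gcongr; linarith)
  have g1 : n * F ((1 - η) * y) ≤ (1 + ε / 4) * s := by
    calc _ ≤ n * ((1 + ε / 4) * F y) := by gcongr
      _ = _ := by rw [hsdef]; ring
  have g2 : (1 - ε / 4) * s ≤ n * F ((1 + η) * y) := by
    calc _ = n * ((1 - ε / 4) * F y) := by rw [hsdef]; ring
      _ ≤ _ := by gcongr
  have g3 : (n * F (τ * y)) ^ 2 ≤ ε / 4 * s := by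
    calc _ ≤ (K * s) ^ 2 := by
          gcongr
          exact mul_nonneg hn0 (hpos _).le
      _ = K ^ 2 * s * s := by ring
      _ ≤ _ := by gcongr
  have g4 : (n * F ((1 + η) * y)) ^ 2 ≤ ε / 4 * s := by
    calc _ ≤ s ^ 2 := by
          refine pow_le_pow_left₀ (mul_nonneg hn0 (hpos _).le) ?_ 2
          refine mul_le_mul_of_nonneg_left (tailDist_antitone P (X 0) ?_) hn0
          nlinarith
      _ = s * s := sq s
      _ ≤ _ := by gcongr
  rw [abs_le]
  have hεs : 0 ≤ ε * s := by positivity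
  constructor <;> linarith

end Uniform

theorem mainTheorem5 {Ω : Type*} [MeasurableSpace Ω] (P : Measure Ω) [IsProbabilityMeasure P]
    (X : ℕ → Ω → ℝ) (hmeas : ∀ k, Measurable (X k))
    (hnonneg : ∀ k, ∀ᵐ ω ∂P, 0 ≤ X k ω)
    (hindep : iIndepFun X P) (hident : ∀ k, IdentDistrib (X k) (X 0) P P)
    (β : ℝ) (hβ : β ∈ Set.Ioo (0 : ℝ) 2 \ {1})
    (hRV : IsRegularlyVarying (tailDist P (X 0)) β)
    (x : ℕ → ℝ) (hx : Tendsto x atTop atTop)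
    (hx' : Tendsto (fun n : ℕ => (n : ℝ) * tailDist P (X 0) (x n)) atTop (𝓝 0)) :
    (1 < β → ∀ k, Integrable (X k) P) ∧
    Tendsto
      (fun n : ℕ => ⨆ y ∈ Set.Ici (x n),
        ENNReal.ofReal |tailDist P (fun ω => partialSum X n ω - centering P X β n) y /
          ((n : ℝ) * tailDist P (X 0) y) - 1|)
      atTop (𝓝 0) := by
  have hF := tailDist_antitone P (X 0)
  have hpos : ∀ y, 0 < tailDist P (X 0) y := hRV.pos hF fun _ => measureReal_nonneg
  have hint : 1 < β → ∀ k, Integrable (X k) P := by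
    intro h1 k
    obtain ⟨C, -, M, -, h⟩ := exists_lintegral_tail_le (hmeas 0) h1 hRV hpos
    exact (hident k).integrable_iff.2 (integrable_of_lintegral_tail (hmeas 0) (hnonneg 0)
      (ne_top_of_le_ne_top ENNReal.ofReal_ne_top (h M le_rfl)))
  refine ⟨hint, ENNReal.tendsto_nhds_zero.2 fun e he => ?_⟩
  obtain ⟨ε, hε, hεe⟩ : ∃ ε : ℝ, 0 < ε ∧ ENNReal.ofReal ε ≤ e := by
    rcases eq_or_ne e ⊤ with rfl | h
    · exact ⟨1, one_pos, le_top⟩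
    · exact ⟨e.toReal, ENNReal.toReal_pos he.ne' h, (ENNReal.ofReal_toReal h).le⟩
  obtain ⟨δ, hδ, M, hM⟩ := exists_abs_tailDist_partialSum_sub_le hmeas hnonneg hindep hident
    hβ.1.2 hβ.2 hRV hpos hint hε
  filter_upwards [hx.eventually_ge_atTop M, hx'.eventually (gt_mem_nhds hδ),
    eventually_gt_atTop 0] with n h1 h2 hn
  refine iSup₂_le fun y hy => (ENNReal.ofReal_le_ofReal ?_).trans hεe
  have hn' : (0 : ℝ) < n := Nat.cast_pos.2 hn
  have hs : 0 < n * tailDist P (X 0) y := mul_pos hn' (hpos y)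
  -- Monotonicity of the tail turns smallness at `x n` into smallness at every `y ≥ x n`.
  have h3 := hM n y (h1.trans hy) ((mul_le_mul_of_nonneg_left (hF hy) hn'.le).trans h2.le)
  rwa [div_sub_one hs.ne', abs_div, abs_of_pos hs, div_le_iff₀ hs]
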